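/- Let $n\ge 1$, $A\in\mathbb{R}^{n\times d}$, $y\in\mathbb{R}^n$, $\lambda>0$, $\eta>0$, and let $W\in\mathbb{R}^{d\times k}$ satisfy $WW^T=I$ (a normalized tight frame). Let $\mathbb{R}^k_+=(0,\infty)^k$, $D_\theta=\operatorname{diag}(\theta)$, and for $u\in\mathbb{R}^d$, $\theta\in\mathbb{R}^k_+$ put $$\mathsf J(u,\theta)=\frac1{2n}\|y-Au\|_2^2+\frac{\lambda}{2\sqrt2}\sum_{j=1}^k\frac{(W^Tu)_j^2}{\theta_j}+\frac{\lambda}{\sqrt2}\sum_{j=1}^k(\theta_j-\eta\log\theta_j),\qquad f_j(u)=\frac\eta2+\sqrt{\frac{\eta^2}4+\frac{(W^Tu)_j^2}2}.$$ A MAP estimator is a minimizer of $\mathsf J$ over $\mathbb{R}^d\times\mathbb{R}^k_+$. The O-IAS algorithm starts from some $\theta^0\in\mathbb{R}^k_+$ and iterates, for $\ell\ge0$, $$u^{\ell+1}=\Bigl(\frac{A^TA}{n}+\frac{\lambda}{\sqrt2}WD_{\theta^\ell}^{-1}W^T\Bigr)^{-1}\frac{A^Ty}{n},\qquad \theta_j^{\ell+1}=f_j(u^{\ell+1}),\quad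 1\le j\le k.$$ Write $\|x\|_C=\sqrt{x^TC^{-1}x}$ for the Mahalanobis norm of a positive definite matrix $C$. Then: 1. $\mathsf J$ is strictly convex on $\mathbb{R}^d\times\mathbb{R}^k_+$, and there is exactly one MAP estimator $(\hat u,\hat\theta)$. 2. The $u$-iterates converge at least linearly to $\hat u$ in the norm $\|\cdot\|_{(WD_{\hat\theta}^{-1}W^T)^{-1}}$, that is, $\|x\|^2=x^TWD_{\hat\theta}^{-1}W^Tx$: there is $\rho\in(0,1)$ such that for every initialization $\theta^0\in\mathbb{R}^k_+$ we have $\|u^\ell-\hat u\|_{(WD_{\hat\theta}^{-1}W^T)^{-1}}\to0$ and, for all sufficiently large $\ell$, $$\|u^{\ell+1}-\hat u\|_{(WD_{\hat\theta}^{-1}W^T)^{-1}}\le\rho\,\|u^{\ell}-\hat u\|_{(WD_{\hat\theta}^{-1}W^T)^{-1}}.$$ 3. Let $$\mathsf F(u)=\frac1{2n}\|y-Au\|_2^2+\lambda\mathsf R_\eta(u),\qquad \mathsf R_\eta(u)=\frac1{\sqrt2}\sum_{j=1}^k\Bigl[\frac{(W^Tu)_j^2}{2f_j(u)}+f_j(u)-\eta\log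 f_j(u)\Bigr].$$ Then $\lambda\mathsf R_\eta$ is convex on $\mathbb{R}^d$, and $\hat u$ is the unique global minimizer of $\mathsf F$ over $\mathbb{R}^d$. -/

import Mathlib

open Matrix Filter Topology

noncomputable section

namespace OIAS

/-- The open positive orthant `ℝ^k_+` of variance vectors `θ`. -/
def posOrthant (k : ℕ) : Set (Fin k → ℝ) := {θ | ∀ j, 0 < θ j}

/-- The data misfit `‖y - A u‖₂² / (2n)`. -/
def misfit {n d : ℕ} (A : Matrix (Fin n) (Fin d) ℝ) (y : Fin n → ℝ) (u : Fin d → ℝ) : ℝ :=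
  1 / (2 * (n : ℝ)) * ∑ i, (y i - (A *ᵥ u) i) ^ 2

/-- The negative log-posterior `J(u, θ)` (up to an additive constant); only its values at positive
`θ` are meaningful. -/
def J {n d k : ℕ} (A : Matrix (Fin n) (Fin d) ℝ) (W : Matrix (Fin d) (Fin k) ℝ) (y : Fin n → ℝ)
    (lam η : ℝ) (u : Fin d → ℝ) (θ : Fin k → ℝ) : ℝ :=
  misfit A y u
    + lam / (2 * √2) * ∑ j, (Wᵀ *ᵥ u) j ^ 2 / θ j
    + lam / √2 * ∑ j, (θ j - η * Real.log (θ j))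

/-- `(u, θ)` is a MAP estimator: a global minimizer of `J` over `ℝ^d × ℝ^k_+`. -/
def IsMAP {n d k : ℕ} (A : Matrix (Fin n) (Fin d) ℝ) (W : Matrix (Fin d) (Fin k) ℝ)
    (y : Fin n → ℝ) (lam η : ℝ) (u : Fin d → ℝ) (θ : Fin k → ℝ) : Prop :=
  θ ∈ posOrthant k ∧
    ∀ u' : Fin d → ℝ, ∀ θ' ∈ posOrthant k, J A W y lam η u θ ≤ J A W y lam η u' θ'

/-- `f_j(u) = η/2 + √(η²/4 + (Wᵀu)_j² / 2)`. -/
def f {d k : ℕ} (W : Matrix (Fin d) (Fin k) ℝ) (η : ℝ) (u : Fin d → ℝ) : Fin k → ℝ :=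
  fun j => η / 2 + √(η ^ 2 / 4 + (Wᵀ *ᵥ u) j ^ 2 / 2)

/-- The matrix `W D_θ⁻¹ Wᵀ`, where `D_θ = diag(θ)`. -/
def precision {d k : ℕ} (W : Matrix (Fin d) (Fin k) ℝ) (θ : Fin k → ℝ) :
    Matrix (Fin d) (Fin d) ℝ :=
  W * (Matrix.diagonal θ)⁻¹ * Wᵀ

/-- `(u^ℓ)`, `(θ^ℓ)` are iterates of the O-IAS algorithm: it is started at a positive `θ⁰` and
alternates the `u`-update (the minimizer of `J(·, θ^ℓ)`, written in closed form) with the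
`θ`-update (the minimizer of `J(u^{ℓ+1}, ·)`, written in closed form).
The value `u 0` is arbitrary, and is not used by the algorithm. -/
structure IsIterates {n d k : ℕ} (A : Matrix (Fin n) (Fin d) ℝ) (W : Matrix (Fin d) (Fin k) ℝ)
    (y : Fin n → ℝ) (lam η : ℝ) (u : ℕ → Fin d → ℝ) (θ : ℕ → Fin k → ℝ) : Prop where
  init : θ 0 ∈ posOrthant k
  u_update : ∀ l, u (l + 1) =
    ((1 / (n : ℝ)) • (Aᵀ * A) + (lam / √2) • precision W (θ l))⁻¹ *ᵥ ((1 / (n : ℝ)) • (Aᵀ *ᵥ y))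
  θ_update : ∀ l, θ (l + 1) = f W η (u (l + 1))

/-- The Mahalanobis norm `‖x‖_C = √(xᵀ C⁻¹ x)` of a positive definite matrix `C`. -/
def mahalanobis {d : ℕ} (C : Matrix (Fin d) (Fin d) ℝ) (x : Fin d → ℝ) : ℝ :=
  √(x ⬝ᵥ (C⁻¹ *ᵥ x))

/-- The regularizer `R_η`. -/
def R {d k : ℕ} (W : Matrix (Fin d) (Fin k) ℝ) (η : ℝ) (u : Fin d → ℝ) : ℝ :=
  1 / √2 * ∑ j, ((Wᵀ *ᵥ u) j ^ 2 / (2 * f W η u j) + f W η u j - η * Real.log (f W η u j))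

/-- The objective `F(u) = ‖y - A u‖₂² / (2n) + λ R_η(u)`. -/
def F {n d k : ℕ} (A : Matrix (Fin n) (Fin d) ℝ) (W : Matrix (Fin d) (Fin k) ℝ) (y : Fin n → ℝ)
    (lam η : ℝ) (u : Fin d → ℝ) : ℝ :=
  misfit A y u + lam * R W η u

end OIAS

end

namespace OIAS

/-! Up to the factor `lam / √2`, the prior part of `J` is a sum of scalar penalties `s²/(2θ) + θ - η
log θ` at `s = (Wᵀu)_j`. Each is jointly strictly convex: `s²/θ` is a perspective, `-log` is
strictly convex, and `Wᵀ` is injective because `W * Wᵀ = 1`. The variance update minimizes the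
penalty in `θ`, so `F` is the partial minimum of `J` over `θ`. Hence the regularizer is convex,
minimizers of `F` yield MAP estimators, and coercivity of `F` gives existence.

For the rate, subtract the normal equations of one iterate and of `uhat`, and drop the nonnegative
data term. The update is Lipschitz with constant `1/√2`, and `τ(τ - η) = t²/2` at the limit
variances. Together these contract the squared error by some `q < 1` with `1 - η/τ ≤ q` for each
limit variance `τ`, in the norm of the current variances (`energy_sub_le_mul_energy_sub`).

This norm moves with the iteration, so the contraction cannot simply be iterated. Instead it bounds
the error by the step length, which the decrease of `F` sends to zero (`tendsto_energy_sub`). The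
variances then converge, and the moving norm can be exchanged for the fixed one at an arbitrarily
small loss in the rate. -/

/-- The scalar variance update `s ↦ η/2 + √(η²/4 + s²/2)`. -/
noncomputable def scalarVariance (η s : ℝ) : ℝ := η / 2 + √(η ^ 2 / 4 + s ^ 2 / 2)

/-- The scalar penalty `s²/(2θ) + θ - η log θ`. -/
noncomputable def scalarPenalty (η s θ : ℝ) : ℝ := s ^ 2 / (2 * θ) + θ - η * Real.log θ

/-! ### The scalar penalty and its minimizing variance. -/

section Scalar

variable {η : ℝ}

lemma continuous_scalarVariance (η : ℝ) : Continuous (scalarVariance η) := by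
  unfold scalarVariance
  fun_prop

lemma le_scalarVariance (η s : ℝ) : η ≤ scalarVariance η s := by
  have : η / 2 ≤ √(η ^ 2 / 4 + s ^ 2 / 2) := Real.le_sqrt_of_sq_le (by nlinarith [sq_nonneg s])
  unfold scalarVariance
  linarith

lemma scalarVariance_pos (hη : 0 < η) (s : ℝ) : 0 < scalarVariance η s :=
  hη.trans_le (le_scalarVariance η s)

lemma scalarVariance_mul_sub (η s : ℝ) :
    scalarVariance η s * (scalarVariance η s - η) = s ^ 2 / 2 := by
  have h := Real.sq_sqrt (show 0 ≤ η ^ 2 / 4 + s ^ 2 / 2 by positivity)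
  unfold scalarVariance
  linear_combination h

lemma abs_le_two_mul_scalarVariance (hη : 0 < η) (s : ℝ) : |s| ≤ 2 * scalarVariance η s := by
  apply abs_le_of_sq_le_sq _ (by linarith [scalarVariance_pos hη s])
  nlinarith [scalarVariance_mul_sub η s, scalarVariance_pos hη s]

/-- The root is the Euclidean norm of `(η/2, s/√2)`; Cauchy–Schwarz gives the reverse triangle
inequality. -/
lemma two_mul_sq_scalarVariance_sub_le (η s t : ℝ) :
    2 * (scalarVariance η s - scalarVariance η t) ^ 2 ≤ (s - t) ^ 2 := by
  have hs := Real.sq_sqrt (show 0 ≤ η ^ 2 / 4 + s ^ 2 / 2 by positivity)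
  have ht := Real.sq_sqrt (show 0 ≤ η ^ 2 / 4 + t ^ 2 / 2 by positivity)
  have h : η ^ 2 / 4 + s * t / 2 ≤ √(η ^ 2 / 4 + s ^ 2 / 2) * √(η ^ 2 / 4 + t ^ 2 / 2) := by
    apply le_of_abs_le
    apply abs_le_of_sq_le_sq _ (by positivity)
    rw [mul_pow, hs, ht]
    nlinarith [mul_nonneg (sq_nonneg η) (sq_nonneg (s - t))]
  unfold scalarVariance
  nlinarith

lemma scalarVariance_le_add_abs (η s t : ℝ) :
    scalarVariance η s ≤ scalarVariance η t + |s - t| := by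
  have h := two_mul_sq_scalarVariance_sub_le η s t
  have : |scalarVariance η s - scalarVariance η t| ≤ |s - t| :=
    sq_le_sq.mp (by nlinarith [sq_nonneg (scalarVariance η s - scalarVariance η t)])
  linarith [le_abs_self (scalarVariance η s - scalarVariance η t)]

/-- The weighted perturbation estimate behind the contraction of the iteration. -/
lemma scalarVariance_mul_sq_le (hη : 0 < η) {q : ℝ} (s t : ℝ)
    (hq : scalarVariance η t - η ≤ q * scalarVariance η t) :
    scalarVariance η s * ((1 / scalarVariance η t - 1 / scalarVariance η s) * t) ^ 2 ≤
      q * ((s - t) ^ 2 / scalarVariance η s) := by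
  have hγ := scalarVariance_pos hη s
  have hτ := scalarVariance_pos hη t
  have hL := two_mul_sq_scalarVariance_sub_le η s t
  have ht := scalarVariance_mul_sub η t
  have hle := le_scalarVariance η t
  set γ := scalarVariance η s
  set τ := scalarVariance η t
  -- Eliminating `t²` leaves the factor `(τ - η)/τ < 1`, the source of the contraction.
  have e : γ * ((1 / τ - 1 / γ) * t) ^ 2 = 2 * (γ - τ) ^ 2 * ((τ - η) / τ) / γ := by
    have : t ^ 2 = 2 * (τ * (τ - η)) := by linarith
    rw [mul_pow, this]
    field_simp
  have hq' : (τ - η) / τ ≤ q := (div_le_iff₀ hτ).2 hq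
  rw [e, ← mul_div_assoc q]
  refine div_le_div_of_nonneg_right ?_ hγ.le
  rw [mul_comm q]
  have : 0 ≤ (τ - η) / τ := div_nonneg (by linarith) hτ.le
  exact mul_le_mul hL hq' this (sq_nonneg _)

/-- After `log x ≤ x - 1` at `x = θ/γ`, the gap is at least `(γ - θ)²(γ - η)/(θγ) ≥ 0`. -/
lemma scalarPenalty_scalarVariance_le (hη : 0 < η) (s : ℝ) {θ : ℝ} (hθ : 0 < θ) :
    scalarPenalty η s (scalarVariance η s) ≤ scalarPenalty η s θ := by
  have hγ := scalarVariance_pos hη s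
  have hle := le_scalarVariance η s
  have hs := scalarVariance_mul_sub η s
  unfold scalarPenalty
  set γ := scalarVariance η s
  have hlog := Real.log_le_sub_one_of_pos (div_pos hθ hγ)
  rw [Real.log_div hθ.ne' hγ.ne'] at hlog
  have h1 : s ^ 2 = 2 * (γ * (γ - η)) := by linarith
  have h2 : 0 ≤ (γ - θ) ^ 2 * (γ - η) / (θ * γ) :=
    div_nonneg (mul_nonneg (sq_nonneg _) (by linarith)) (by positivity)
  have h3 : 2 * (γ * (γ - η)) / (2 * θ) + θ - (2 * (γ * (γ - η)) / (2 * γ) + γ)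
      - η * (θ / γ - 1) = (γ - θ) ^ 2 * (γ - η) / (θ * γ) := by
    field_simp
    ring
  rw [h1]
  nlinarith

/-- Coercivity in `θ`: the tangent to `log` at `2η` uses up only half of the linear term. -/
lemma div_two_sub_le_scalarPenalty (hη : 0 < η) (s : ℝ) {θ : ℝ} (hθ : 0 < θ) :
    θ / 2 - η * Real.log (2 * η) ≤ scalarPenalty η s θ := by
  have hlog := Real.log_le_sub_one_of_pos (show 0 < θ / (2 * η) by positivity)
  rw [Real.log_div hθ.ne' (by positivity)] at hlog
  have h1 : 0 ≤ s ^ 2 / (2 * θ) := by positivity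
  have h2 : η * (θ / (2 * η)) = θ / 2 := by field_simp
  unfold scalarPenalty
  nlinarith

lemma sq_div_combo (s t : ℝ) {θ τ a b : ℝ} (hθ : 0 < θ) (hτ : 0 < τ) (ha : 0 < a)
    (hb : 0 < b) :
    a * (s ^ 2 / (2 * θ)) + b * (t ^ 2 / (2 * τ)) - (a * s + b * t) ^ 2 / (2 * (a * θ + b * τ)) =
      a * b * (s * τ - t * θ) ^ 2 / (2 * θ * τ * (a * θ + b * τ)) := by
  have : 0 < a * θ + b * τ := by positivity
  field_simp
  ring

/-- Strictness comes from the logarithm if `θ ≠ τ`, and otherwise from the square `s²`. -/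
lemma scalarPenalty_combo_lt (hη : 0 < η) {s t θ τ a b : ℝ} (hθ : 0 < θ) (hτ : 0 < τ)
    (ha : 0 < a) (hb : 0 < b) (hab : a + b = 1) (hne : s ≠ t ∨ θ ≠ τ) :
    scalarPenalty η (a * s + b * t) (a * θ + b * τ) <
      a * scalarPenalty η s θ + b * scalarPenalty η t τ := by
  have hsq := sq_div_combo s t hθ hτ ha hb
  have hpos : 0 < a * θ + b * τ := by positivity
  unfold scalarPenalty
  rcases eq_or_ne θ τ with rfl | h
  · have hst : s ≠ t := by tauto
    have : 0 < a * b * (s * θ - t * θ) ^ 2 / (2 * θ * θ * (a * θ + b * θ)) := by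
      have : 0 < (s * θ - t * θ) ^ 2 := by
        rw [← sub_mul]
        have := sub_ne_zero.2 hst
        positivity
      positivity
    have e : a * θ + b * θ = θ := by rw [← add_mul, hab, one_mul]
    rw [← hsq] at this
    rw [e] at this ⊢
    have e2 : a * (η * Real.log θ) + b * (η * Real.log θ) = η * Real.log θ := by
      rw [← add_mul, hab, one_mul]
    linarith
  · have hl := strictConcaveOn_log_Ioi.2 (x := θ) (y := τ) hθ hτ h ha hb hab
    simp only [smul_eq_mul] at hl
    have : 0 ≤ a * b * (s * τ - t * θ) ^ 2 / (2 * θ * τ * (a * θ + b * τ)) := by positivity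
    nlinarith

lemma scalarPenalty_combo_le (hη : 0 < η) {s t θ τ a b : ℝ} (hθ : 0 < θ) (hτ : 0 < τ)
    (ha : 0 < a) (hb : 0 < b) (hab : a + b = 1) :
    scalarPenalty η (a * s + b * t) (a * θ + b * τ) ≤
      a * scalarPenalty η s θ + b * scalarPenalty η t τ := by
  by_cases hne : s ≠ t ∨ θ ≠ τ
  · exact (scalarPenalty_combo_lt hη hθ hτ ha hb hab hne).le
  · push Not at hne
    obtain ⟨rfl, rfl⟩ := hne
    rw [← add_mul, ← add_mul, ← add_mul, hab, one_mul, one_mul, one_mul]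

end Scalar

variable {n d k : ℕ} {A : Matrix (Fin n) (Fin d) ℝ} {W : Matrix (Fin d) (Fin k) ℝ}
  {y : Fin n → ℝ} {lam η : ℝ}

/-! ### Partial minimization and convexity. -/

lemma f_apply (W : Matrix (Fin d) (Fin k) ℝ) (η : ℝ) (u : Fin d → ℝ) (j : Fin k) :
    f W η u j = scalarVariance η ((Wᵀ *ᵥ u) j) := rfl

lemma f_mem_posOrthant (hη : 0 < η) (u : Fin d → ℝ) : f W η u ∈ posOrthant k :=
  fun _ => scalarVariance_pos hη _

lemma J_eq (u : Fin d → ℝ) (θ : Fin k → ℝ) :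
    J A W y lam η u θ =
      misfit A y u + lam / √2 * ∑ j, scalarPenalty η ((Wᵀ *ᵥ u) j) (θ j) := by
  unfold J scalarPenalty
  rw [add_assoc, add_right_inj, Finset.mul_sum, Finset.mul_sum, Finset.mul_sum,
    ← Finset.sum_add_distrib]
  refine Finset.sum_congr rfl fun j _ => ?_
  rw [← div_div, ← div_div, div_div lam 2, mul_comm 2 √2, ← div_div]
  ring

lemma R_eq (u : Fin d → ℝ) :
    R W η u = 1 / √2 * ∑ j, scalarPenalty η ((Wᵀ *ᵥ u) j) (f W η u j) := rfl

lemma F_eq_J (u : Fin d → ℝ) : F A W y lam η u = J A W y lam η u (f W η u) := by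
  rw [J_eq, F, R_eq, ← mul_assoc, mul_one_div]

lemma J_f_le (hlam : 0 < lam) (hη : 0 < η) (u : Fin d → ℝ) {θ : Fin k → ℝ}
    (hθ : θ ∈ posOrthant k) : J A W y lam η u (f W η u) ≤ J A W y lam η u θ := by
  rw [J_eq, J_eq]
  gcongr with j
  exact scalarPenalty_scalarVariance_le hη _ (hθ j)

lemma mulVec_transpose_eq (hW : W * Wᵀ = 1) (u : Fin d → ℝ) : W *ᵥ (Wᵀ *ᵥ u) = u := by
  rw [mulVec_mulVec, hW, one_mulVec]

lemma misfit_combo_le (A : Matrix (Fin n) (Fin d) ℝ) (y : Fin n → ℝ) (u v : Fin d → ℝ) {a b : ℝ}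
    (ha : 0 < a) (hb : 0 < b) (hab : a + b = 1) :
    misfit A y (a • u + b • v) ≤ a * misfit A y u + b * misfit A y v := by
  unfold misfit
  rw [mul_left_comm a, mul_left_comm b, ← mul_add]
  gcongr
  rw [Finset.mul_sum, Finset.mul_sum, ← Finset.sum_add_distrib]
  refine Finset.sum_le_sum fun i _ => ?_
  simp only [mulVec_add, mulVec_smul, Pi.add_apply, Pi.smul_apply, smul_eq_mul]
  obtain rfl : b = 1 - a := by linarith
  nlinarith [mul_nonneg (mul_pos ha hb).le (sq_nonneg ((A *ᵥ u) i - (A *ᵥ v) i))]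

lemma convex_posOrthant (k : ℕ) : Convex ℝ (posOrthant k) := by
  rw [convex_iff_forall_pos]
  intro θ hθ τ hτ a b ha hb _ j
  have := hθ j
  have := hτ j
  simp only [Pi.add_apply, Pi.smul_apply, smul_eq_mul]
  positivity

theorem strictConvexOn_J (hW : W * Wᵀ = 1) (hlam : 0 < lam) (hη : 0 < η) :
    StrictConvexOn ℝ ((Set.univ : Set (Fin d → ℝ)) ×ˢ posOrthant k)
      (fun z => J A W y lam η z.1 z.2) := by
  refine ⟨convex_univ.prod (convex_posOrthant k), ?_⟩
  rintro ⟨u, θ⟩ ⟨-, hθ⟩ ⟨v, τ⟩ ⟨-, hτ⟩ hne a b ha hb hab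
  have hθ : ∀ j, 0 < θ j := hθ
  have hτ : ∀ j, 0 < τ j := hτ
  -- Distinct points differ in some scalar pair, since `W` inverts `Wᵀ` from the left.
  obtain ⟨i, hi⟩ : ∃ j, (Wᵀ *ᵥ u) j ≠ (Wᵀ *ᵥ v) j ∨ θ j ≠ τ j := by
    by_contra! h
    apply hne
    rw [← mulVec_transpose_eq hW u, ← mulVec_transpose_eq hW v, funext fun j => (h j).1,
      funext fun j => (h j).2]
  have hsum : ∑ j, scalarPenalty η (a * (Wᵀ *ᵥ u) j + b * (Wᵀ *ᵥ v) j) (a * θ j + b * τ j) <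
      ∑ j, (a * scalarPenalty η ((Wᵀ *ᵥ u) j) (θ j) +
        b * scalarPenalty η ((Wᵀ *ᵥ v) j) (τ j)) :=
    Finset.sum_lt_sum
      (fun j _ => scalarPenalty_combo_le hη (hθ j) (hτ j) ha hb hab)
      ⟨i, Finset.mem_univ i, scalarPenalty_combo_lt hη (hθ i) (hτ i) ha hb hab hi⟩
  rw [Finset.sum_add_distrib, ← Finset.mul_sum, ← Finset.mul_sum] at hsum
  have hc : 0 < lam / √2 := by positivity
  have hm := misfit_combo_le A y u v ha hb hab
  simp only [Prod.smul_mk, Prod.mk_add_mk, J_eq, smul_eq_mul]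
  simp only [mulVec_add, mulVec_smul, Pi.add_apply, Pi.smul_apply, smul_eq_mul] at hm ⊢
  have := mul_lt_mul_of_pos_left hsum hc
  nlinarith

/-- A partial minimum of a jointly convex function is convex: the optimal variances at the
combination do no worse than the combined variances. -/
theorem convexOn_R (hlam : 0 < lam) (hη : 0 < η) :
    ConvexOn ℝ Set.univ (fun u => lam * R W η u) := by
  rw [convexOn_iff_forall_pos]
  refine ⟨convex_univ, fun u _ v _ a b ha hb hab => ?_⟩
  have hu := f_mem_posOrthant (W := W) hη u
  have hv := f_mem_posOrthant (W := W) hη v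
  have hc : 0 < lam * (1 / √2) := by positivity
  have hsum : ∑ j, scalarPenalty η ((Wᵀ *ᵥ (a • u + b • v)) j) (f W η (a • u + b • v) j) ≤
      ∑ j, (a * scalarPenalty η ((Wᵀ *ᵥ u) j) (f W η u j) +
        b * scalarPenalty η ((Wᵀ *ᵥ v) j) (f W η v j)) := by
    refine Finset.sum_le_sum fun j _ => ?_
    have hu := hu j
    have hv := hv j
    refine le_trans (scalarPenalty_scalarVariance_le hη _
      (show 0 < a * f W η u j + b * f W η v j by positivity)) ?_
    simp only [mulVec_add, mulVec_smul, Pi.add_apply, Pi.smul_apply, smul_eq_mul]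
    exact scalarPenalty_combo_le hη hu hv ha hb hab
  rw [Finset.sum_add_distrib, ← Finset.mul_sum, ← Finset.mul_sum] at hsum
  simp only [R_eq, smul_eq_mul, ← mul_assoc]
  have := mul_le_mul_of_nonneg_left hsum hc.le
  linarith

/-! ### Existence and uniqueness of the minimizer. -/

lemma continuous_F (hη : 0 < η) : Continuous (F A W y lam η) := by
  have hf : ∀ j, Continuous fun u => f W η u j := fun j => by
    unfold f
    fun_prop
  have hpos : ∀ u j, f W η u j ≠ 0 := fun u j => (f_mem_posOrthant hη u j).ne'
  unfold F misfit R
  refine Continuous.add (by fun_prop) (continuous_const.mul (continuous_const.mul ?_))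
  refine continuous_finsetSum _ fun j _ => ?_
  refine ((Continuous.div (by fun_prop) (continuous_const.mul (hf j)) fun u => ?_).add
    (hf j)).sub (continuous_const.mul ((hf j).log (hpos · j)))
  exact mul_ne_zero two_ne_zero (hpos u j)

lemma norm_le_sum_abs (hW : W * Wᵀ = 1) (u : Fin d → ℝ) :
    ‖u‖ ≤ (∑ i, ∑ j, |W i j|) * ∑ j, |(Wᵀ *ᵥ u) j| := by
  rw [pi_norm_le_iff_of_nonneg (by positivity)]
  intro i
  conv_lhs => rw [← mulVec_transpose_eq hW u]
  calc ‖(W *ᵥ (Wᵀ *ᵥ u)) i‖ ≤ ∑ j, |W i j * (Wᵀ *ᵥ u) j| := 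
      Finset.abs_sum_le_sum_abs (fun j => W i j * (Wᵀ *ᵥ u) j) Finset.univ
    _ ≤ ∑ j, (∑ i, ∑ j, |W i j|) * |(Wᵀ *ᵥ u) j| := by
        refine Finset.sum_le_sum fun j _ => ?_
        rw [abs_mul]
        gcongr
        exact (Finset.single_le_sum (f := fun j => |W i j|) (fun _ _ => abs_nonneg _)
          (Finset.mem_univ j)).trans (Finset.single_le_sum (f := fun i => ∑ j, |W i j|)
            (fun _ _ => Finset.sum_nonneg fun _ _ => abs_nonneg _) (Finset.mem_univ i))
    _ = _ := by rw [Finset.mul_sum]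

lemma misfit_nonneg (A : Matrix (Fin n) (Fin d) ℝ) (y : Fin n → ℝ) (u : Fin d → ℝ) :
    0 ≤ misfit A y u := by
  unfold misfit
  positivity

lemma tendsto_F_cocompact (hW : W * Wᵀ = 1) (hlam : 0 < lam) (hη : 0 < η) :
    Tendsto (F A W y lam η) (cocompact (Fin d → ℝ)) atTop := by
  set K := ∑ i, ∑ j, |W i j|
  have hK : 0 ≤ K := by positivity
  set c := lam / √2
  have hc : 0 < c := by positivity
  set C := c * ∑ _j : Fin k, η * Real.log (2 * η)
  -- Linear growth: the penalty dominates `f/2`, `f` dominates `|s|/2`, and the `|s|` control `‖u‖`.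
  -- Using `K + 1` avoids division by zero.
  have hbound : ∀ u, c / (4 * (K + 1)) * ‖u‖ - C ≤ F A W y lam η u := fun u => by
    have h1 : ∑ j, (|(Wᵀ *ᵥ u) j| / 4 - η * Real.log (2 * η)) ≤
        ∑ j, scalarPenalty η ((Wᵀ *ᵥ u) j) (f W η u j) := by
      refine Finset.sum_le_sum fun j _ => ?_
      have h2 := div_two_sub_le_scalarPenalty hη ((Wᵀ *ᵥ u) j)
        (scalarVariance_pos hη ((Wᵀ *ᵥ u) j))
      have h3 := abs_le_two_mul_scalarVariance hη ((Wᵀ *ᵥ u) j)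
      rw [f_apply]
      linarith
    rw [Finset.sum_sub_distrib, ← Finset.sum_div] at h1
    have h4 : ‖u‖ / (K + 1) ≤ ∑ j, |(Wᵀ *ᵥ u) j| := by
      rw [div_le_iff₀ (by positivity)]
      have := norm_le_sum_abs hW u
      have : 0 ≤ ∑ j, |(Wᵀ *ᵥ u) j| := by positivity
      nlinarith
    have h5 := misfit_nonneg A y u
    rw [F_eq_J, J_eq]
    have h6 := mul_le_mul_of_nonneg_left h1 hc.le
    have h7 : c / (4 * (K + 1)) * ‖u‖ = c * (‖u‖ / (K + 1) / 4) := by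
      field_simp
    have h8 := mul_le_mul_of_nonneg_left (div_le_div_of_nonneg_right h4 zero_le_four) hc.le
    rw [mul_sub] at h6
    linarith
  refine tendsto_atTop_mono hbound (tendsto_atTop_add_const_right _ _ ?_)
  exact (tendsto_norm_cocompact_atTop).const_mul_atTop (by positivity)

theorem exists_forall_F_le (hW : W * Wᵀ = 1) (hlam : 0 < lam) (hη : 0 < η) :
    ∃ u, ∀ v, F A W y lam η u ≤ F A W y lam η v :=
  (continuous_F hη).exists_forall_le (tendsto_F_cocompact hW hlam hη)

lemma isMAP_of_forall_F_le (hlam : 0 < lam) (hη : 0 < η) {u : Fin d → ℝ}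
    (hu : ∀ v, F A W y lam η u ≤ F A W y lam η v) : IsMAP A W y lam η u (f W η u) := by
  refine ⟨f_mem_posOrthant hη u, fun v θ hθ => ?_⟩
  rw [← F_eq_J]
  exact (hu v).trans ((F_eq_J v).trans_le (J_f_le hlam hη v hθ))

lemma IsMAP.unique (hW : W * Wᵀ = 1) (hlam : 0 < lam) (hη : 0 < η) {u v : Fin d → ℝ}
    {θ τ : Fin k → ℝ} (hu : IsMAP A W y lam η u θ) (hv : IsMAP A W y lam η v τ) :
    u = v ∧ θ = τ := by
  have h := (strictConvexOn_J (A := A) (y := y) hW hlam hη).eq_of_isMinOn (x := (u, θ)) (y := (v, τ))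
    (fun z hz => hu.2 z.1 z.2 hz.2) (fun z hz => hv.2 z.1 z.2 hz.2) ⟨trivial, hu.1⟩ ⟨trivial, hv.1⟩
  exact Prod.mk.inj h

/-! ### Weighted norms and normal equations. -/

/-- The squared weighted norm `xᵀ W D_θ⁻¹ Wᵀ x`. -/
noncomputable def energy (W : Matrix (Fin d) (Fin k) ℝ) (θ : Fin k → ℝ) (x : Fin d → ℝ) : ℝ :=
  ∑ j, (Wᵀ *ᵥ x) j ^ 2 / θ j

lemma energy_nonneg {θ : Fin k → ℝ} (hθ : θ ∈ posOrthant k) (x : Fin d → ℝ) :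
    0 ≤ energy W θ x :=
  Finset.sum_nonneg fun j _ => div_nonneg (sq_nonneg _) (hθ j).le

lemma energy_pos (hW : W * Wᵀ = 1) {θ : Fin k → ℝ} (hθ : θ ∈ posOrthant k) {x : Fin d → ℝ}
    (hx : x ≠ 0) : 0 < energy W θ x := by
  refine (energy_nonneg hθ x).lt_of_ne fun h => hx ?_
  have h0 := (Finset.sum_eq_zero_iff_of_nonneg
    (fun j _ => div_nonneg (sq_nonneg _) (hθ j).le)).1 h.symm
  have : Wᵀ *ᵥ x = 0 := funext fun j => by
    have := h0 j (Finset.mem_univ j)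
    simpa [(hθ j).ne'] using this
  rw [← mulVec_transpose_eq hW x, this, mulVec_zero]

lemma dotProduct_precision_mulVec {θ : Fin k → ℝ} (hθ : θ ∈ posOrthant k) (x z : Fin d → ℝ) :
    x ⬝ᵥ (precision W θ *ᵥ z) = ∑ j, (Wᵀ *ᵥ x) j * (Wᵀ *ᵥ z) j / θ j := by
  have hinv : (diagonal θ)⁻¹ = diagonal (fun j => (θ j)⁻¹) := by
    apply inv_eq_right_inv
    rw [diagonal_mul_diagonal, ← diagonal_one]
    exact congrArg diagonal (funext fun j => mul_inv_cancel₀ (hθ j).ne')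
  rw [precision, hinv, ← mulVec_mulVec, ← mulVec_mulVec, dotProduct_mulVec, ← mulVec_transpose]
  refine Finset.sum_congr rfl fun j _ => ?_
  rw [mulVec_diagonal]
  ring

lemma dotProduct_precision_mulVec_self {θ : Fin k → ℝ} (hθ : θ ∈ posOrthant k) (x : Fin d → ℝ) :
    x ⬝ᵥ (precision W θ *ᵥ x) = energy W θ x := by
  simp only [dotProduct_precision_mulVec hθ, energy, sq]

lemma isUnit_of_dotProduct_mulVec_pos {M : Matrix (Fin d) (Fin d) ℝ}
    (hM : ∀ x, x ≠ 0 → 0 < x ⬝ᵥ (M *ᵥ x)) : IsUnit M := by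
  rw [← mulVec_injective_iff_isUnit]
  intro x z hxz
  by_contra hne
  have := hM (x - z) (sub_ne_zero.2 hne)
  rw [mulVec_sub, show M *ᵥ x = M *ᵥ z from hxz, sub_self, dotProduct_zero] at this
  exact this.false

lemma mahalanobis_precision_inv (hW : W * Wᵀ = 1) {θ : Fin k → ℝ} (hθ : θ ∈ posOrthant k)
    (x : Fin d → ℝ) : mahalanobis (precision W θ)⁻¹ x = √(energy W θ x) := by
  have h : IsUnit (precision W θ) := isUnit_of_dotProduct_mulVec_pos fun x hx => by
    rw [dotProduct_precision_mulVec_self hθ]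
    exact energy_pos hW hθ hx
  rw [mahalanobis, nonsing_inv_nonsing_inv _ ((isUnit_iff_isUnit_det _).1 h),
    dotProduct_precision_mulVec_self hθ]

/-- The weak form of the normal equations for the minimization of `J(·, θ)`. -/
def SolvesNormalEq (A : Matrix (Fin n) (Fin d) ℝ) (W : Matrix (Fin d) (Fin k) ℝ) (y : Fin n → ℝ)
    (lam : ℝ) (θ : Fin k → ℝ) (u : Fin d → ℝ) : Prop :=
  ∀ v, 1 / (n : ℝ) * ∑ i, (A *ᵥ v) i * (A *ᵥ u) i
    + lam / √2 * ∑ j, (Wᵀ *ᵥ v) j * (Wᵀ *ᵥ u) j / θ j = 1 / (n : ℝ) * ∑ i, (A *ᵥ v) i * y i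

lemma dotProduct_transpose_mulVec_eq (A : Matrix (Fin n) (Fin d) ℝ) (v : Fin d → ℝ)
    (z : Fin n → ℝ) : v ⬝ᵥ (Aᵀ *ᵥ z) = ∑ i, (A *ᵥ v) i * z i := by
  rw [dotProduct_mulVec, vecMul_transpose, dotProduct]

lemma dotProduct_normalMatrix_mulVec {θ : Fin k → ℝ} (hθ : θ ∈ posOrthant k) (v u : Fin d → ℝ) :
    v ⬝ᵥ (((1 / (n : ℝ)) • (Aᵀ * A) + (lam / √2) • precision W θ) *ᵥ u) =
      1 / (n : ℝ) * ∑ i, (A *ᵥ v) i * (A *ᵥ u) i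
        + lam / √2 * ∑ j, (Wᵀ *ᵥ v) j * (Wᵀ *ᵥ u) j / θ j := by
  rw [add_mulVec, smul_mulVec, smul_mulVec, dotProduct_add, dotProduct_smul, dotProduct_smul,
    dotProduct_precision_mulVec hθ, ← mulVec_mulVec, dotProduct_transpose_mulVec_eq,
    smul_eq_mul, smul_eq_mul]

lemma solvesNormalEq_inv_mulVec (hW : W * Wᵀ = 1) (hlam : 0 < lam) {θ : Fin k → ℝ}
    (hθ : θ ∈ posOrthant k) :
    SolvesNormalEq A W y lam θ (((1 / (n : ℝ)) • (Aᵀ * A) + (lam / √2) • precision W θ)⁻¹ *ᵥ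
      ((1 / (n : ℝ)) • (Aᵀ *ᵥ y))) := by
  intro v
  rw [← dotProduct_normalMatrix_mulVec hθ, mulVec_mulVec, mul_nonsing_inv, one_mulVec,
    dotProduct_smul, dotProduct_transpose_mulVec_eq, smul_eq_mul]
  rw [← isUnit_iff_isUnit_det]
  refine isUnit_of_dotProduct_mulVec_pos fun x hx => ?_
  rw [dotProduct_normalMatrix_mulVec hθ]
  have h1 := energy_pos hW hθ hx
  have h2 : 0 ≤ ∑ i, (A *ᵥ x) i * (A *ᵥ x) i := Finset.sum_nonneg fun i _ => mul_self_nonneg _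
  simp only [energy, sq] at h1
  positivity

lemma misfit_add (A : Matrix (Fin n) (Fin d) ℝ) (y : Fin n → ℝ) (u v : Fin d → ℝ) :
    misfit A y (u + v) = misfit A y u + 1 / (2 * (n : ℝ)) * ∑ i, (A *ᵥ v) i ^ 2
      + 1 / (n : ℝ) * (∑ i, (A *ᵥ v) i * (A *ᵥ u) i - ∑ i, (A *ᵥ v) i * y i) := by
  have h : 1 / (n : ℝ) = 1 / (2 * (n : ℝ)) * 2 := by
    rw [one_div, one_div, mul_inv]
    ring
  rw [misfit, misfit, h, mul_assoc, ← mul_add, ← mul_add, mulVec_add, ← Finset.sum_sub_distrib,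
    Finset.mul_sum _ _ (2 : ℝ), ← Finset.sum_add_distrib, ← Finset.sum_add_distrib]
  congr 1
  refine Finset.sum_congr rfl fun i _ => ?_
  rw [Pi.add_apply]
  ring

lemma sum_scalarPenalty_add {θ : Fin k → ℝ} (hθ : θ ∈ posOrthant k) (s t : Fin k → ℝ) :
    ∑ j, scalarPenalty η ((s + t) j) (θ j) = ∑ j, scalarPenalty η (s j) (θ j)
      + 1 / 2 * ∑ j, t j ^ 2 / θ j + ∑ j, t j * s j / θ j := by
  rw [Finset.mul_sum, ← Finset.sum_add_distrib, ← Finset.sum_add_distrib]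
  refine Finset.sum_congr rfl fun j _ => ?_
  have := (hθ j).ne'
  rw [scalarPenalty, scalarPenalty, Pi.add_apply]
  field_simp
  ring

/-- The exact second-order expansion of `J(·, θ)` at its minimizer. -/
lemma SolvesNormalEq.J_eq {θ : Fin k → ℝ} {u : Fin d → ℝ} (hu : SolvesNormalEq A W y lam θ u)
    (hθ : θ ∈ posOrthant k) (v : Fin d → ℝ) :
    J A W y lam η v θ = J A W y lam η u θ + 1 / (2 * (n : ℝ)) * ∑ i, (A *ᵥ (v - u)) i ^ 2
      + lam / √2 / 2 * energy W θ (v - u) := by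
  obtain ⟨w, rfl⟩ : ∃ w, v = u + w := ⟨v - u, by abel⟩
  have h := hu w
  rw [OIAS.J_eq, OIAS.J_eq, misfit_add, mulVec_add, sum_scalarPenalty_add hθ, add_sub_cancel_left,
    energy]
  linear_combination h

lemma SolvesNormalEq.energy_sub_le {θ : Fin k → ℝ} {u : Fin d → ℝ}
    (hu : SolvesNormalEq A W y lam θ u) (hθ : θ ∈ posOrthant k) (v : Fin d → ℝ) :
    lam / √2 / 2 * energy W θ (v - u) ≤ J A W y lam η v θ - J A W y lam η u θ := by
  have : 0 ≤ 1 / (2 * (n : ℝ)) * ∑ i, (A *ᵥ (v - u)) i ^ 2 := by positivity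
  rw [hu.J_eq hθ v]
  linarith

/-- The normal equations have a solution `w`; the quadratic gap `energy W θ (u - w)` forces any
minimizer to equal it. -/
lemma IsMAP.solvesNormalEq (hW : W * Wᵀ = 1) (hlam : 0 < lam) {u : Fin d → ℝ} {θ : Fin k → ℝ}
    (h : IsMAP A W y lam η u θ) : SolvesNormalEq A W y lam θ u := by
  obtain ⟨w, hw⟩ : ∃ w, SolvesNormalEq A W y lam θ w :=
    ⟨_, solvesNormalEq_inv_mulVec hW hlam h.1⟩
  suffices u = w from this ▸ hw
  by_contra hne
  have h1 := hw.energy_sub_le (η := η) h.1 u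
  have h2 := h.2 w θ h.1
  have h3 := energy_pos hW h.1 (sub_ne_zero.2 hne)
  have : 0 < lam / √2 / 2 * energy W θ (u - w) := by positivity
  linarith

/-! ### Contraction and convergence. -/

/-- One step of the iteration contracts the distance to the MAP estimator, measured in the
norm induced by the current variances. -/
lemma energy_sub_le_mul_energy_sub (hlam : 0 < lam) (hη : 0 < η) {q : ℝ} {uhat u v : Fin d → ℝ}
    (hhat : SolvesNormalEq A W y lam (f W η uhat) uhat)
    (hv : SolvesNormalEq A W y lam (f W η u) v)
    (hq : ∀ j, f W η uhat j - η ≤ q * f W η uhat j) :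
    energy W (f W η u) (v - uhat) ≤ q * energy W (f W η u) (u - uhat) := by
  have hc : 0 < lam / √2 := by positivity
  have hθ := f_mem_posOrthant (W := W) hη u
  have h1 := hhat (v - uhat)
  have h2 := hv (v - uhat)
  have hA : ∑ i, (A *ᵥ (v - uhat)) i * (A *ᵥ v) i =
      ∑ i, (A *ᵥ (v - uhat)) i ^ 2 + ∑ i, (A *ᵥ (v - uhat)) i * (A *ᵥ uhat) i := by
    rw [← Finset.sum_add_distrib]
    refine Finset.sum_congr rfl fun i _ => ?_
    simp only [mulVec_sub, Pi.sub_apply]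
    ring
  have hA0 : 0 ≤ 1 / (n : ℝ) * ∑ i, (A *ᵥ (v - uhat)) i ^ 2 := by positivity
  rw [hA] at h2
  -- Subtracting the two equations and discarding `‖A(v - uhat)‖²/n`.
  have h3 : ∑ j, (Wᵀ *ᵥ (v - uhat)) j * (Wᵀ *ᵥ v) j / f W η u j ≤
      ∑ j, (Wᵀ *ᵥ (v - uhat)) j * (Wᵀ *ᵥ uhat) j / f W η uhat j :=
    le_of_mul_le_mul_left (by linarith) hc
  have h4 : ∀ j, (Wᵀ *ᵥ (v - uhat)) j * (Wᵀ *ᵥ uhat) j / f W η uhat j ≤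
      (Wᵀ *ᵥ (v - uhat)) j * (Wᵀ *ᵥ v) j / f W η u j
        - (Wᵀ *ᵥ (v - uhat)) j ^ 2 / f W η u j / 2
        + q * ((Wᵀ *ᵥ (u - uhat)) j ^ 2 / f W η u j) / 2 := fun j => by
    have h := scalarVariance_mul_sq_le hη ((Wᵀ *ᵥ u) j) ((Wᵀ *ᵥ uhat) j) (hq j)
    simp only [mulVec_sub, Pi.sub_apply]
    rw [← f_apply, ← f_apply] at h
    set t := (Wᵀ *ᵥ uhat) j
    set s := (Wᵀ *ᵥ v) j
    have hγ := hθ j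
    set γ := f W η u j
    set τ := f W η uhat j
    -- Young's inequality for the cross term `(s - t)(1/τ - 1/γ)t`, as a completed square with
    -- weight `γ`.
    have h5 : 0 ≤ ((s - t) - γ * ((1 / τ - 1 / γ) * t)) ^ 2 / γ :=
      div_nonneg (sq_nonneg _) hγ.le
    have h6 : ((s - t) - γ * ((1 / τ - 1 / γ) * t)) ^ 2 / γ = (s - t) ^ 2 / γ
        - 2 * ((s - t) * t / τ) + 2 * ((s - t) * t / γ) + γ * ((1 / τ - 1 / γ) * t) ^ 2 := by
      have : τ ≠ 0 := (f_mem_posOrthant (W := W) hη uhat j).ne'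
      field_simp
      ring
    have h7 : (s - t) * s / γ = (s - t) ^ 2 / γ + (s - t) * t / γ := by ring
    linarith
  have h5 := h3.trans (Finset.sum_le_sum fun j _ => h4 j)
  rw [Finset.sum_add_distrib, Finset.sum_sub_distrib, ← Finset.sum_div, ← Finset.sum_div,
    ← Finset.mul_sum] at h5
  unfold energy
  linarith

/-- Weighted Young inequality with parameter `(1 - q)/(2q)`: once `b` contracts by `q`, its
coefficient becomes `(1 + q)/2 < 1` and can be absorbed. -/
lemma energy_add_le {q : ℝ} (hq0 : 0 < q) (hq1 : q < 1) {θ : Fin k → ℝ} (hθ : θ ∈ posOrthant k)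
    (a b : Fin d → ℝ) :
    energy W θ (a + b) ≤
      (1 + q) / (1 - q) * energy W θ a + (1 + q) / (2 * q) * energy W θ b := by
  unfold energy
  rw [Finset.mul_sum, Finset.mul_sum, ← Finset.sum_add_distrib]
  refine Finset.sum_le_sum fun j _ => ?_
  rw [mulVec_add, Pi.add_apply, ← mul_div_assoc, ← mul_div_assoc, ← add_div]
  refine div_le_div_of_nonneg_right ?_ (hθ j).le
  generalize (Wᵀ *ᵥ a) j = s
  generalize (Wᵀ *ᵥ b) j = t
  have h1 : 0 < 1 - q := by linarith
  have : (1 + q) / (1 - q) * s ^ 2 + (1 + q) / (2 * q) * t ^ 2 - (s + t) ^ 2 =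
      (2 * q * s - (1 - q) * t) ^ 2 / (2 * q * (1 - q)) := by
    field_simp
    ring
  have : 0 ≤ (2 * q * s - (1 - q) * t) ^ 2 / (2 * q * (1 - q)) := by positivity
  linarith

/-- The denominators are not known to be bounded, but they grow at most linearly in `|s - t|` while
the numerator is quadratic. -/
lemma tendsto_of_tendsto_sq_div_scalarVariance (hη : 0 < η) {s : ℕ → ℝ} {t : ℝ}
    (h : Tendsto (fun l => (s l - t) ^ 2 / scalarVariance η (s l)) atTop (𝓝 0)) :
    Tendsto s atTop (𝓝 t) := by
  rw [Metric.tendsto_nhds]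
  intro ε hε
  have hτ := scalarVariance_pos hη t
  filter_upwards [h.eventually_lt_const (show 0 < ε ^ 2 / (scalarVariance η t + ε) by positivity)]
    with l hl
  rw [Real.dist_eq]
  by_contra! hle
  have hγ := scalarVariance_pos hη (s l)
  rw [div_lt_div_iff₀ hγ (by positivity), ← sq_abs (s l - t)] at hl
  have h1 := scalarVariance_le_add_abs η (s l) t
  nlinarith [mul_le_mul_of_nonneg_left h1 (sq_nonneg ε), mul_nonneg hε.le (sub_nonneg.2 hle),
    mul_nonneg (mul_nonneg hε.le (abs_nonneg (s l - t))) (sub_nonneg.2 hle),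
    mul_nonneg hτ.le (mul_nonneg (add_nonneg hε.le (abs_nonneg (s l - t))) (sub_nonneg.2 hle))]

lemma tendsto_energy_sub (hlam : 0 < lam) (hη : 0 < η) {q : ℝ} (hq0 : 0 < q) (hq1 : q < 1)
    {uhat : Fin d → ℝ} (hmin : ∀ v, F A W y lam η uhat ≤ F A W y lam η v)
    (hhat : SolvesNormalEq A W y lam (f W η uhat) uhat)
    (hq : ∀ j, f W η uhat j - η ≤ q * f W η uhat j) {v : ℕ → Fin d → ℝ}
    (hv : ∀ l, SolvesNormalEq A W y lam (f W η (v l)) (v (l + 1))) :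
    Tendsto (fun l => energy W (f W η (v l)) (v l - uhat)) atTop (𝓝 0) := by
  have hθ : ∀ l, f W η (v l) ∈ posOrthant k := fun l => f_mem_posOrthant hη _
  have hc : 0 < lam / √2 / 2 := by positivity
  have hdesc : ∀ l, lam / √2 / 2 * energy W (f W η (v l)) (v l - v (l + 1)) ≤
      F A W y lam η (v l) - F A W y lam η (v (l + 1)) := fun l => by
    have h1 := (hv l).energy_sub_le (η := η) (hθ l) (v l)
    have h2 := J_f_le (A := A) (W := W) (y := y) hlam hη (v (l + 1)) (hθ l)
    rw [F_eq_J, F_eq_J]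
    linarith
  have hanti : Antitone fun l => F A W y lam η (v l) := antitone_nat_of_succ_le fun l => by
    have := mul_nonneg hc.le (energy_nonneg (W := W) (hθ l) (v l - v (l + 1)))
    linarith [hdesc l]
  have hlim := tendsto_atTop_ciInf hanti
    ⟨F A W y lam η uhat, by rintro _ ⟨l, rfl⟩; exact hmin (v l)⟩
  have hdiff := hlim.sub (hlim.comp (tendsto_add_atTop_nat 1))
  rw [sub_self] at hdiff
  have hq1' : 0 < 1 - q := by linarith
  have hm : 0 < lam / √2 / 2 * ((1 - q) / 2 * ((1 - q) / (1 + q))) := by positivity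
  -- The error is bounded by the step `v l - v (l + 1)`, and the step by the decrease of `F`, which
  -- tends to zero as `F` is monotone and bounded below along the iterates.
  have hbound : ∀ l, lam / √2 / 2 * ((1 - q) / 2 * ((1 - q) / (1 + q))) *
      energy W (f W η (v l)) (v l - uhat) ≤ F A W y lam η (v l) - F A W y lam η (v (l + 1)) :=
    fun l => by
      have h1 := energy_add_le (W := W) hq0 hq1 (hθ l) (v l - v (l + 1)) (v (l + 1) - uhat)
      rw [sub_add_sub_cancel] at h1
      have h2 := energy_sub_le_mul_energy_sub hlam hη hhat (hv l) hq
      have h3 : (1 + q) / (2 * q) * energy W (f W η (v l)) (v (l + 1) - uhat) ≤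
          (1 + q) / 2 * energy W (f W η (v l)) (v l - uhat) := by
        refine (mul_le_mul_of_nonneg_left h2 (by positivity)).trans_eq ?_
        field_simp
      have h4 : (1 - q) / 2 * energy W (f W η (v l)) (v l - uhat) ≤
          (1 + q) / (1 - q) * energy W (f W η (v l)) (v l - v (l + 1)) := by linarith
      have h5 := mul_le_mul_of_nonneg_left h4 (show 0 ≤ (1 - q) / (1 + q) by positivity)
      have h6 : (1 - q) / (1 + q) *
          ((1 + q) / (1 - q) * energy W (f W η (v l)) (v l - v (l + 1))) =
            energy W (f W η (v l)) (v l - v (l + 1)) := by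
        field_simp
      rw [h6] at h5
      refine le_trans ?_ (hdesc l)
      rw [mul_assoc]
      refine mul_le_mul_of_nonneg_left ?_ hc.le
      linarith
  have h := squeeze_zero
    (fun l => mul_nonneg hm.le (energy_nonneg (hθ l) (v l - uhat))) hbound hdiff
  have h' := h.const_mul (lam / √2 / 2 * ((1 - q) / 2 * ((1 - q) / (1 + q))))⁻¹
  simpa only [inv_mul_cancel_left₀ hm.ne', mul_zero] using h'

lemma tendsto_mulVec_of_tendsto_energy_sub (hη : 0 < η) {uhat : Fin d → ℝ} {v : ℕ → Fin d → ℝ}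
    (h : Tendsto (fun l => energy W (f W η (v l)) (v l - uhat)) atTop (𝓝 0)) (j : Fin k) :
    Tendsto (fun l => (Wᵀ *ᵥ v l) j) atTop (𝓝 ((Wᵀ *ᵥ uhat) j)) := by
  refine tendsto_of_tendsto_sq_div_scalarVariance hη (squeeze_zero (fun l => ?_) (fun l => ?_) h)
  · exact div_nonneg (sq_nonneg _) (scalarVariance_pos hη _).le
  · have := Finset.single_le_sum (f := fun j => (Wᵀ *ᵥ (v l - uhat)) j ^ 2 / f W η (v l) j)
      (fun j _ => div_nonneg (sq_nonneg _) (f_mem_posOrthant hη _ j).le) (Finset.mem_univ j)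
    simpa [mulVec_sub, f_apply, energy] using this

lemma energy_le_mul_energy {θ τ : Fin k → ℝ} {r : ℝ} (hθ : θ ∈ posOrthant k)
    (hτ : τ ∈ posOrthant k) (h : ∀ j, τ j ≤ r * θ j) (x : Fin d → ℝ) :
    energy W θ x ≤ r * energy W τ x := by
  unfold energy
  rw [Finset.mul_sum]
  refine Finset.sum_le_sum fun j _ => ?_
  have hθ := hθ j
  have hτ := hτ j
  rw [← mul_div_assoc, div_le_div_iff₀ hθ hτ]
  nlinarith [mul_le_mul_of_nonneg_left (h j) (sq_nonneg ((Wᵀ *ᵥ x) j))]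

/-- Global convergence of the alternating minimization, with an eventually linear rate. -/
theorem convergence_of_solvesNormalEq (hlam : 0 < lam) (hη : 0 < η) {q : ℝ} (hq0 : 0 < q)
    (hq1 : q < 1) {uhat : Fin d → ℝ} (hmin : ∀ v, F A W y lam η uhat ≤ F A W y lam η v)
    (hhat : SolvesNormalEq A W y lam (f W η uhat) uhat)
    (hq : ∀ j, f W η uhat j - η ≤ q * f W η uhat j) {v : ℕ → Fin d → ℝ}
    (hv : ∀ l, SolvesNormalEq A W y lam (f W η (v l)) (v (l + 1))) :
    Tendsto (fun l => energy W (f W η uhat) (v l - uhat)) atTop (𝓝 0) ∧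
      ∀ᶠ l in atTop, energy W (f W η uhat) (v (l + 1) - uhat) ≤
        (1 + q) / 2 * energy W (f W η uhat) (v l - uhat) := by
  have hs := tendsto_mulVec_of_tendsto_energy_sub hη
    (tendsto_energy_sub hlam hη hq0 hq1 hmin hhat hq hv)
  have hτ : ∀ j, 0 < f W η uhat j := f_mem_posOrthant hη uhat
  have hθ : ∀ l, f W η (v l) ∈ posOrthant k := fun l => f_mem_posOrthant hη _
  refine ⟨?_, ?_⟩
  · have h : Tendsto (fun l => ∑ j, ((Wᵀ *ᵥ v l) j - (Wᵀ *ᵥ uhat) j) ^ 2 / f W η uhat j) atTop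
        (𝓝 (∑ j, ((Wᵀ *ᵥ uhat) j - (Wᵀ *ᵥ uhat) j) ^ 2 / f W η uhat j)) :=
      tendsto_finsetSum _ fun j _ => (((hs j).sub_const _).pow 2).div_const _
    simpa [energy, mulVec_sub] using h
  · have hf : ∀ j, Tendsto (fun l => f W η (v l) j) atTop (𝓝 (f W η uhat j)) := fun j =>
      ((continuous_scalarVariance η).tendsto _).comp (hs j)
    -- Chosen so that `q(1 + ε)/(1 - ε) = (1 + q)/2`.
    set ε := (1 - q) / (1 + 3 * q)
    have hε : 0 < ε := div_pos (by linarith) (by linarith)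
    have hε1 : ε < 1 := by
      rw [div_lt_one (by linarith)]
      linarith
    have h1ε : 0 < 1 - ε := by linarith
    have hupper : ∀ᶠ l in atTop, ∀ j, f W η (v l) j ≤ (1 + ε) * f W η uhat j :=
      eventually_all.2 fun j => (hf j).eventually_le_const (by nlinarith [hτ j])
    have hlower : ∀ᶠ l in atTop, ∀ j, (1 - ε) * f W η uhat j ≤ f W η (v l) j :=
      eventually_all.2 fun j => (hf j).eventually_const_le (by nlinarith [hτ j])
    filter_upwards [hupper, hlower] with l hu hl
    have h1 := energy_le_mul_energy (W := W) hτ (hθ l) hu (v (l + 1) - uhat)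
    have h2 := energy_sub_le_mul_energy_sub hlam hη hhat (hv l) hq
    have h3 := energy_le_mul_energy (W := W) (r := (1 - ε)⁻¹) (hθ l) hτ
      (fun j => by rw [inv_mul_eq_div, le_div_iff₀ h1ε, mul_comm]; exact hl j) (v l - uhat)
    calc _ ≤ (1 + ε) * (q * ((1 - ε)⁻¹ * energy W (f W η uhat) (v l - uhat))) := by
          refine h1.trans (mul_le_mul_of_nonneg_left (h2.trans ?_) (by linarith))
          exact mul_le_mul_of_nonneg_left h3 hq0.le
      _ = _ := by
          have h4 : 1 - ε = 4 * q / (1 + 3 * q) := by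
            simp only [ε]
            field_simp
            ring
          have h5 : 1 + ε = 2 * (1 + q) / (1 + 3 * q) := by
            simp only [ε]
            field_simp
            ring
          rw [h4, h5]
          field_simp
          ring

end OIAS

theorem theorem2p3 {n d k : ℕ} (hn : 0 < n)
    (A : Matrix (Fin n) (Fin d) ℝ) (W : Matrix (Fin d) (Fin k) ℝ) (hW : W * Wᵀ = 1)
    (y : Fin n → ℝ) (lam η : ℝ) (hlam : 0 < lam) (hη : 0 < η) :
    StrictConvexOn ℝ ((Set.univ : Set (Fin d → ℝ)) ×ˢ OIAS.posOrthant k)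
      (fun z => OIAS.J A W y lam η z.1 z.2) ∧
    ∃ (uhat : Fin d → ℝ) (θhat : Fin k → ℝ),
      -- unique MAP estimator
      OIAS.IsMAP A W y lam η uhat θhat ∧
      (∀ u θ, OIAS.IsMAP A W y lam η u θ → u = uhat ∧ θ = θhat) ∧
      -- global convergence of the `u`-iterates, at least linear, with a rate constant that
      -- does not depend on the initialization
      (∃ ρ : ℝ, 0 < ρ ∧ ρ < 1 ∧
        ∀ (u : ℕ → Fin d → ℝ) (θ : ℕ → Fin k → ℝ), OIAS.IsIterates A W y lam η u θ →
          Tendsto (fun l => OIAS.mahalanobis (OIAS.precision W θhat)⁻¹ (u l - uhat))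
            atTop (𝓝 0) ∧
          ∃ L : ℕ, ∀ l ≥ L,
            OIAS.mahalanobis (OIAS.precision W θhat)⁻¹ (u (l + 1) - uhat) ≤
              ρ * OIAS.mahalanobis (OIAS.precision W θhat)⁻¹ (u l - uhat)) ∧
      -- `F` has a convex regularization term, and `uhat` is its unique global minimizer
      ConvexOn ℝ Set.univ (fun u => lam * OIAS.R W η u) ∧
      (∀ u, OIAS.F A W y lam η uhat ≤ OIAS.F A W y lam η u) ∧
      (∀ u, (∀ v, OIAS.F A W y lam η u ≤ OIAS.F A W y lam η v) → u = uhat) := by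
  obtain ⟨uhat, hmin⟩ := OIAS.exists_forall_F_le (A := A) (y := y) hW hlam hη
  have hMAP := OIAS.isMAP_of_forall_F_le hlam hη hmin
  have hhat := hMAP.solvesNormalEq hW hlam
  have hτ : ∀ j, 0 < OIAS.f W η uhat j := OIAS.f_mem_posOrthant hη uhat
  refine ⟨OIAS.strictConvexOn_J hW hlam hη, uhat, OIAS.f W η uhat, hMAP,
    fun u θ h => h.unique hW hlam hη hMAP, ?_, OIAS.convexOn_R hlam hη, hmin,
    fun u h => ((OIAS.isMAP_of_forall_F_le hlam hη h).unique hW hlam hη hMAP).1⟩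
  set S := ∑ j, OIAS.f W η uhat j
  have hS : 0 ≤ S := Finset.sum_nonneg fun j _ => (hτ j).le
  obtain ⟨q, hq0, hq1, hq⟩ : ∃ q : ℝ, 0 < q ∧ q < 1 ∧
      ∀ j, OIAS.f W η uhat j - η ≤ q * OIAS.f W η uhat j := by
    -- Here `q = 1 - η/(S + 1 + η)`, and each variance is at most `S`; the `+ 1` keeps `q` positive
    -- when `k = 0`.
    refine ⟨(S + 1) / (S + 1 + η), by positivity, (div_lt_one (by positivity)).2 (by linarith),
      fun j => ?_⟩
    have hj : OIAS.f W η uhat j ≤ S :=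
      Finset.single_le_sum (fun j _ => (hτ j).le) (Finset.mem_univ j)
    rw [div_mul_eq_mul_div, le_div_iff₀ (by positivity)]
    nlinarith
  -- The square root passes from the squared norm to the norm.
  refine ⟨√((1 + q) / 2), by positivity, (Real.sqrt_lt' one_pos).2 (by linarith),
    fun u θ h => ?_⟩
  -- The sequence is shifted by one: `u 0` is arbitrary and `θ 0` need not be `f W η (u 0)`.
  have hv : ∀ l, OIAS.SolvesNormalEq A W y lam (OIAS.f W η (u (l + 1))) (u (l + 1 + 1)) :=
    fun l => by
      rw [h.u_update (l + 1), h.θ_update l]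
      exact OIAS.solvesNormalEq_inv_mulVec hW hlam (OIAS.f_mem_posOrthant hη _)
  obtain ⟨hlim, hrate⟩ := OIAS.convergence_of_solvesNormalEq (v := fun l => u (l + 1))
    hlam hη hq0 hq1 hmin hhat hq hv
  simp only [OIAS.mahalanobis_precision_inv hW hMAP.1]
  refine ⟨?_, ?_⟩
  · rw [← tendsto_add_atTop_iff_nat 1]
    simpa using hlim.sqrt
  · obtain ⟨L, hL⟩ := eventually_atTop.1 hrate
    refine ⟨L + 1, fun l hl => ?_⟩
    obtain ⟨m, rfl⟩ : ∃ m, l = m + 1 := ⟨l - 1, by omega⟩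
    rw [← Real.sqrt_mul (by positivity)]
    exact Real.sqrt_le_sqrt (hL m (by omega))
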